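/- **Decidability of SSTL verification.** For $n\in\mathbb N$, the SSTL formulae over signals $x_1,\dots,x_n$ are generated by $$\varphi ::= \top \mid x_i\ge 0 \mid \neg\varphi \mid \varphi_1\wedge\varphi_2 \mid \varphi_1\,\mathcal U_{[a,b]}\,\varphi_2 ,\qquad a\in\mathbb N,\ b\in\mathbb N\cup\{\infty\},$$ where $a,b$ are numbers of ticks ($b=\infty$ meaning the interval $[a,\infty)$). A trace is a function $w:\mathbb N\to\mathbb R^n$. Satisfaction at a tick $t\in\mathbb N$ is defined as usual for $\top,\neg,\wedge$, by $(w,t)\models x_i\ge 0$ iff $w(t)_i\ge 0$, and by $$(w,t)\models\varphi_1\,\mathcal U_{[a,b]}\,\varphi_2\iff \exists t'\in\mathbb N,\ t+a\le t'\le t+b:\ (w,t')\models\varphi_2 \text{ and } (w,t'')\models\varphi_1 \text{ for all } t\le t''<t'.$$ A finite-state system $M$ with $n$ signals consists of a finite set of states, a set of initial states, a transition relation, and a map assigning to each state a vector of $n$ rational signal values. A run is an infinite sequence of states $s_0s_1s_2\dots$ that starts in an initial state and follows the transition relation; its trace sends $k$ to the signal values of $s_k$. Write $M\models\varphi$ if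 $(w,0)\models\varphi$ for the trace $w$ of every run of $M$. The following problem is decidable (under an explicit injective coding of the inputs as finite data): given $n\in\mathbb N$, a finite-state system $M$ with $n$ signals and an SSTL formula $\varphi$ over $n$ signals, does $M\models\varphi$ hold? -/

import Mathlib

namespace SSTL

/-- SSTL formulae over `n` signals `x_0, …, x_{n-1}`. The bounds of a timed until are the
discretised bounds, i.e. numbers of ticks; an upper bound `⊤` gives the interval `[a, +∞)`, so that
the untimed until is `untl 0 ⊤`. -/
inductive Formula (n : ℕ) : Type
  | top : Formula n
  | nonneg (i : Fin n) : Formula n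
  | neg (φ : Formula n) : Formula n
  | and (φ ψ : Formula n) : Formula n
  | untl (a : ℕ) (b : ℕ∞) (φ ψ : Formula n) : Formula n

/-- An SSTL trace maps ticks to vectors of signal values. -/
abbrev Trace (n : ℕ) : Type := ℕ → Fin n → ℝ

/-- `Sat w t φ` is `(w, t) ⊨ φ`, the boolean semantics of SSTL at tick `t`. -/
def Sat {n : ℕ} (w : Trace n) : ℕ → Formula n → Prop
  | _, .top => True
  | t, .nonneg i => 0 ≤ w t i
  | t, .neg φ => ¬ Sat w t φ
  | t, .and φ ψ => Sat w t φ ∧ Sat w t ψ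
  | t, .untl a b φ ψ =>
      ∃ t' : ℕ, t + a ≤ t' ∧ (t' : ℕ∞) ≤ (t : ℕ∞) + b ∧ Sat w t' ψ ∧
        ∀ t'' : ℕ, t ≤ t'' → t'' < t' → Sat w t'' φ

/-- A finite-state system with `n` signals: a finite transition system with initial states,
each state of which fixes the (finite-precision, i.e. rational) values of the signals. -/
structure System (n : ℕ) : Type where
  numStates : ℕ
  init : Fin numStates → Bool
  trans : Fin numStates → Fin numStates → Bool
  value : Fin numStates → Fin n → ℚ

/-- The (infinite) runs of a system. -/
def System.IsRun {n : ℕ} (M : System n) (ρ : ℕ → Fin M.numStates) : Prop :=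
  M.init (ρ 0) = true ∧ ∀ k, M.trans (ρ k) (ρ (k + 1)) = true

/-- The SSTL trace produced by a sequence of states. -/
def System.trace {n : ℕ} (M : System n) (ρ : ℕ → Fin M.numStates) : Trace n :=
  fun k i => (M.value (ρ k) i : ℝ)

/-- `M ⊨ φ`: the trace of every run of `M` satisfies `φ` at tick `0`. -/
def System.Satisfies {n : ℕ} (M : System n) (φ : Formula n) : Prop :=
  ∀ ρ : ℕ → Fin M.numStates, M.IsRun ρ → Sat (M.trace ρ) 0 φ

/-- An instance of the SSTL verification problem. -/
structure Instance : Type where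
  numSignals : ℕ
  system : System numSignals
  formula : Formula numSignals

/-- Tokens of codes of formulae: a tag and up to two numerical arguments. -/
abbrev Token : Type := ℕ × ℕ × Option ℕ

/-- Reverse Polish notation of a formula. -/
def Formula.encode {n : ℕ} : Formula n → List Token
  | .top => [(0, 0, none)]
  | .nonneg i => [(1, i, none)]
  | .neg φ => φ.encode ++ [(2, 0, none)]
  | .and φ ψ => φ.encode ++ ψ.encode ++ [(3, 0, none)]
  | .untl a b φ ψ =>
      φ.encode ++ ψ.encode ++ [(4, a, b.recTopCoe none some)]

/-- Codes of systems: the number of states, the list of initial flags, the transition matrix, and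
the matrix of the signal values, a rational being given by its reduced numerator and denominator. -/
abbrev SystemCode : Type := ℕ × List Bool × List (List Bool) × List (List (ℤ × ℕ))

/-- The code of a system. -/
def System.encode {n : ℕ} (M : System n) : SystemCode :=
  (M.numStates, List.ofFn M.init, List.ofFn fun s => List.ofFn (M.trans s),
    List.ofFn fun s => List.ofFn fun i => ((M.value s i).num, (M.value s i).den))

/-- Codes of instances of the verification problem (finite words, as inputs of an algorithm). -/
abbrev Code : Type := ℕ × SystemCode × List Token

/-- The code of an instance: the number of signals, the system and the formula. -/
def Instance.encode (I : Instance) : Code :=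
  (I.numSignals, I.system.encode, I.formula.encode)

/-- One step of a stack machine that reads formulae in reverse Polish notation. -/
def parseStep {n : ℕ} (st : List (Formula n)) (c : Token) : List (Formula n) :=
  match c, st with
  | (0, _, _), st => .top :: st
  | (1, i, _), st => if h : i < n then .nonneg ⟨i, h⟩ :: st else st
  | (2, _, _), φ :: st => .neg φ :: st
  | (3, _, _), ψ :: φ :: st => .and φ ψ :: st
  | (4, a, none), ψ :: φ :: st => .untl a ⊤ φ ψ :: st
  | (4, a, some b), ψ :: φ :: st => .untl a b φ ψ :: st
  | _, st => st

theorem foldl_parseStep_encode {n : ℕ} (φ : Formula n) :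
    ∀ st : List (Formula n), φ.encode.foldl parseStep st = φ :: st := by
  induction φ with
  | top => intro st; simp [Formula.encode, parseStep]
  | nonneg i => intro st; simp [Formula.encode, parseStep]
  | neg φ ih => intro st; simp [Formula.encode, parseStep, ih]
  | and φ ψ ih₁ ih₂ => intro st; simp [Formula.encode, parseStep, ih₁, ih₂]
  | untl a b φ ψ ih₁ ih₂ =>
    intro st
    induction b using ENat.recTopCoe <;> simp [Formula.encode, parseStep, ih₁, ih₂]

theorem Formula.encode_injective {n : ℕ} :
    Function.Injective (Formula.encode : Formula n → List Token) := by
  intro φ ψ h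
  have h₁ := foldl_parseStep_encode φ []
  rw [h, foldl_parseStep_encode ψ []] at h₁
  simpa using h₁.symm

theorem System.encode_injective {n : ℕ} :
    Function.Injective (System.encode : System n → SystemCode) := by
  rintro ⟨N, i, t, v⟩ ⟨N', i', t', v'⟩ h
  simp only [System.encode, Prod.mk.injEq] at h
  obtain ⟨rfl, hi, ht, hv⟩ := h
  have hi' := List.ofFn_injective hi
  have ht' : t = t' := by
    funext s
    exact List.ofFn_injective (congrFun (List.ofFn_injective ht) s)
  have hv' : v = v' := by
    funext s j
    have := congrFun (List.ofFn_injective (congrFun (List.ofFn_injective hv) s)) j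
    simp only [Prod.mk.injEq] at this
    exact Rat.ext this.1 this.2
  subst hi' ht' hv'
  rfl

/-- Distinct instances have distinct codes. -/
theorem Instance.encode_injective : Function.Injective Instance.encode := by
  rintro ⟨n, M, φ⟩ ⟨n', M', φ'⟩ h
  simp only [Instance.encode, Prod.mk.injEq] at h
  obtain ⟨rfl, hM, hφ⟩ := h
  rw [System.encode_injective hM, Formula.encode_injective hφ]

end SSTL

/-!
A system violates a formula if and only if it has a violating run in the shape of a lasso whose
length is at most `lassoBound`, a primitive recursive function of the number of states and the code
of the formula. The decision procedure evaluates the formula on all these lassos.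

The bound (`System.exists_lasso_run`) comes from a pumping argument. Call the *type* of a tick of a
run the current state together with the truth values of the formulae in the closure of `φ`, that
is, its subformulae and the timed untils obtained by lowering bounds. There are finitely many types,
so a run is an infinite path in a finite graph. By `exists_lasso` it can be replaced by a short
lasso that uses only steps of the path and whose loop passes through every type that occurs
infinitely often. The truth value of a closure formula at a tick is determined by the truth values
at this tick and the next one, except that an unbounded until may be postponed forever. If this
happened on the lasso, the until would hold and its right argument fail at all late ticks of the
original run, since the loop sees all types occurring there; this is impossible. So truth values are
preserved (`sat_iff_of_simulation`).

On a lasso the truth tables of the subformulae are computed by a stack machine reading the reverse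
Polish code (`foldl_evalStep_encode`). An until is tested by a search bounded by the length of the
lasso (`sat_untl_iff_of_lasso`). Token lists that are not codes of formulae are recognised by a
similar stack machine, which only keeps track of the height of the stack. Everything is built from folds
over lists and bounded quantifiers, hence is primitive recursive.
-/

namespace SSTL

/-! ### Lassos and pumping in finite graphs -/

/-- The position reached after `k` steps along a lasso with positions `0, …, L - 1`, in which the
successor of `L - 1` is `p`. Meaningful for `p < L`. -/
def lassoIdx (p L k : ℕ) : ℕ :=
  if k < p then k else p + (k - p) % (L - p)

theorem lassoIdx_lt {p L : ℕ} (h : p < L) (k : ℕ) : lassoIdx p L k < L := by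
  unfold lassoIdx
  split_ifs
  · omega
  · have := Nat.mod_lt (k - p) (show L - p > 0 by omega)
    omega

theorem lassoIdx_of_lt {p L k : ℕ} (hk : k < L) : lassoIdx p L k = k := by
  unfold lassoIdx
  split_ifs
  · rfl
  · rw [Nat.mod_eq_of_lt (by omega)]
    omega

theorem lassoIdx_add_period {p L k : ℕ} (hk : p ≤ k) :
    lassoIdx p L (k + (L - p)) = lassoIdx p L k := by
  unfold lassoIdx
  rw [if_neg (by omega), if_neg (by omega), show k + (L - p) - p = k - p + (L - p) by omega,
    Nat.add_mod_right]

theorem lassoIdx_lassoIdx_add {p L : ℕ} (h : p < L) (k j : ℕ) :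
    lassoIdx p L (lassoIdx p L k + j) = lassoIdx p L (k + j) := by
  by_cases hk : k < p
  · rw [lassoIdx_of_lt (by omega : k < L)]
  · have h1 : lassoIdx p L k = p + (k - p) % (L - p) := by simp [lassoIdx, hk]
    rw [h1]
    unfold lassoIdx
    rw [if_neg (by omega), if_neg (by omega),
      show p + (k - p) % (L - p) + j - p = (k - p) % (L - p) + j by omega,
      show k + j - p = (k - p) + j by omega, Nat.mod_add_mod]

theorem lassoIdx_succ {p L : ℕ} (h : p < L) (k : ℕ) :
    lassoIdx p L (k + 1) = if lassoIdx p L k + 1 < L then lassoIdx p L k + 1 else p := by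
  rw [← lassoIdx_lassoIdx_add h k 1]
  split_ifs with h1
  · exact lassoIdx_of_lt h1
  · have := lassoIdx_lt h k
    rw [show lassoIdx p L k + 1 = p + (L - p) by omega, lassoIdx_add_period le_rfl,
      lassoIdx_of_lt h]

section Pumping

variable {V : Type*} (R : V → V → Prop)

/-- The first `n` steps of `f` form a path from `a` to `b` in the graph `R`. -/
def IsPath (n : ℕ) (f : ℕ → V) (a b : V) : Prop :=
  f 0 = a ∧ f n = b ∧ ∀ i < n, R (f i) (f (i + 1))

variable {R}

theorem IsPath.concat {m n : ℕ} {f g : ℕ → V} {a b c : V} (hf : IsPath R m f a b)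
    (hg : IsPath R n g b c) :
    IsPath R (m + n) (fun i => if i < m then f i else g (i - m)) a c := by
  obtain ⟨hf0, hfm, hf⟩ := hf
  obtain ⟨hg0, hgn, hg⟩ := hg
  refine ⟨?_, by simp [hgn], fun i hi => ?_⟩
  · rcases Nat.eq_zero_or_pos m with rfl | hm
    · simp_all
    · simp [hm, hf0]
  · rcases lt_trichotomy (i + 1) m with h | h | h
    · simpa [show i < m by omega, h] using hf i (by omega)
    · have := hf i (by omega)
      rw [h, hfm, ← hg0] at this
      simpa [show i < m by omega, h] using this
    · have := hg (i - m) (by omega)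
      rw [show i - m + 1 = i + 1 - m by omega] at this
      simpa [show ¬ i < m by omega, show ¬ i + 1 < m by omega] using this

/-- A nonempty path can be shortened until it has at most as many steps as there are vertices. -/
theorem exists_short_path [Fintype V] {K : ℕ} (hK : Fintype.card V ≤ K) {a b : V}
    (h : ∃ n f, 0 < n ∧ IsPath R n f a b) : ∃ n f, 0 < n ∧ n ≤ K ∧ IsPath R n f a b := by
  classical
  have h' : ∃ n, 0 < n ∧ ∃ f, IsPath R n f a b := by
    obtain ⟨n, f, hn, hf⟩ := h
    exact ⟨n, hn, f, hf⟩
  obtain ⟨hn, f, hf0, hfn, hf⟩ := Nat.find_spec h'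
  refine ⟨Nat.find h', f, hn, ?_, hf0, hfn, hf⟩
  by_contra hlt
  set n := Nat.find h' with hndef
  -- Two of the positions `1, …, n` carry the same vertex; cut out what lies between them.
  obtain ⟨i, j, hij, he⟩ : ∃ i j : Fin n, i < j ∧ f (i + 1) = f (j + 1) := by
    obtain ⟨i, j, hne, he⟩ := Fintype.exists_ne_map_eq_of_card_lt (fun i : Fin n => f (i + 1))
      (by simp; omega)
    rcases lt_or_gt_of_ne hne with h | h
    · exact ⟨i, j, h, he⟩
    · exact ⟨j, i, h, he.symm⟩
  have hj := j.2
  have hij' : (i : ℕ) < j := hij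
  refine Nat.find_min h' (m := n - (j - i)) (by omega) ⟨by omega,
    fun k => if k < i + 1 then f k else f (k + (j - i)), by simp [hf0], ?_, fun k hk => ?_⟩
  · have h1 : ¬ n - (j - i) < (i : ℕ) + 1 := by omega
    simp only [h1, if_false]
    rw [show n - (j - i) + ((j : ℕ) - i) = n by omega, hfn]
  · rcases lt_trichotomy (k + 1) (i + 1) with h | h | h
    · simpa [show k < (i : ℕ) + 1 by omega, h] using hf k (by omega)
    · have := hf k (by omega)
      rw [h, he] at this
      have e : k + 1 + ((j : ℕ) - i) = j + 1 := by omega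
      simpa only [show k < (i : ℕ) + 1 by omega, show ¬ k + 1 < (i : ℕ) + 1 by omega, if_true,
        if_false, e] using this
    · have := hf (k + (j - i)) (by omega)
      rw [show k + ((j : ℕ) - i) + 1 = k + 1 + (j - i) by omega] at this
      simpa only [show ¬ k < (i : ℕ) + 1 by omega, show ¬ k + 1 < (i : ℕ) + 1 by omega,
        if_false] using this

/-- Vertices that are pairwise connected by short paths lie on a common path, whose length is
controlled by their number. -/
theorem exists_path_through {K : ℕ} {S : Set V}
    (hS : ∀ a ∈ S, ∀ b ∈ S, ∃ n f, 0 < n ∧ n ≤ K ∧ IsPath R n f a b) (l : List V)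
    (hl : ∀ v ∈ l, v ∈ S) {a b : V} (ha : a ∈ S) (hb : b ∈ S) :
    ∃ n f, 0 < n ∧ n ≤ (l.length + 1) * K ∧ IsPath R n f a b ∧ ∀ v ∈ l, ∃ i < n, f i = v := by
  induction l generalizing a with
  | nil =>
    obtain ⟨n, f, h0, h1, h2⟩ := hS a ha b hb
    exact ⟨n, f, h0, by simpa using h1, h2, by simp⟩
  | cons v l ih =>
    obtain ⟨n, f, h0, h1, h2⟩ := hS a ha v (hl v (by simp))
    obtain ⟨m, g, h0', h1', h2', h3'⟩ := ih (fun u hu => hl u (by simp [hu])) (hl v (by simp))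
    refine ⟨n + m, _, by omega, ?_, h2.concat h2', ?_⟩
    · rw [List.length_cons, add_mul (l.length + 1)]
      omega
    · have hshift : ∀ i, (if n + i < n then f (n + i) else g (n + i - n)) = g i := by
        intro i
        simp
      intro u hu
      rcases List.mem_cons.1 hu with rfl | hu
      · exact ⟨n + 0, by omega, (hshift 0).trans h2'.1⟩
      · obtain ⟨i, hi, he⟩ := h3' u hu
        exact ⟨n + i, by omega, (hshift i).trans he⟩

/-- An infinite sequence in a finite set can be replaced by a lasso of bounded length which only
uses steps of the sequence and whose loop visits everything the sequence visits infinitely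
often. -/
theorem exists_lasso [Fintype V] {K : ℕ} (hK : Fintype.card V ≤ K) (x : ℕ → V) :
    ∃ (p L : ℕ) (y : ℕ → V), p < L ∧ L ≤ K * (K + 2) ∧ y 0 = x 0 ∧
      (∀ k, y k = y (lassoIdx p L k)) ∧
      (∀ k, ∃ t, x t = y k ∧ x (t + 1) = y (k + 1)) ∧
      ∀ k, ∃ T, ∀ t ≥ T, ∃ k' ≥ k, x t = y k' := by
  classical
  let R : V → V → Prop := fun u v => ∃ t, x t = u ∧ x (t + 1) = v
  let S : Set V := {v | ∀ T, ∃ t ≥ T, x t = v}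
  -- After some time only vertices of `S` occur.
  obtain ⟨T, hT⟩ : ∃ T, ∀ t ≥ T, x t ∈ S := by
    have h : ∀ v : V, ∃ T, ∀ t ≥ T, x t = v → v ∈ S := by
      intro v
      by_cases hv : v ∈ S
      · exact ⟨0, fun _ _ _ => hv⟩
      · have hv' := hv
        simp only [S, Set.mem_ofPred_eq, not_forall, not_exists, not_and] at hv
        obtain ⟨T, hT⟩ := hv
        exact ⟨T, fun t ht h => absurd h (hT t ht)⟩
    choose F hF using h
    exact ⟨Finset.univ.sup F, fun t ht =>
      hF (x t) t (le_trans (Finset.le_sup (Finset.mem_univ _)) ht) rfl⟩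
  have seg : ∀ s t, s < t → ∃ n f, 0 < n ∧ n ≤ K ∧ IsPath R n f (x s) (x t) := fun s t hst =>
    exists_short_path hK ⟨t - s, fun i => x (s + i), by omega, rfl,
      by simp [show s + (t - s) = t by omega], fun i _ => ⟨s + i, rfl, rfl⟩⟩
  have hS : ∀ a ∈ S, ∀ b ∈ S, ∃ n f, 0 < n ∧ n ≤ K ∧ IsPath R n f a b := by
    intro a ha b hb
    obtain ⟨s, -, rfl⟩ := ha 0
    obtain ⟨t, ht, rfl⟩ := hb (s + 1)
    exact seg s t ht
  obtain ⟨m, f, hm0, hmK, hf⟩ := seg 0 (T + 1) (by omega)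
  have hvS : x (T + 1) ∈ S := hT _ (by omega)
  obtain ⟨P, g, hP0, hPK, hg, hvis⟩ := exists_path_through hS
    (Finset.univ.filter (· ∈ S)).toList (by simp) hvS hvS
  have hlen : (Finset.univ.filter (· ∈ S)).toList.length ≤ K := by
    rw [Finset.length_toList]
    exact (Finset.card_le_univ _).trans hK
  set h : ℕ → V := fun i => if i < m then f i else g (i - m) with hh
  have hpath : IsPath R (m + P) h _ _ := hf.concat hg
  have hm : h m = x (T + 1) := by simpa [hh] using hg.1
  have hlt : m < m + P := by omega
  refine ⟨m, m + P, fun k => h (lassoIdx m (m + P) k), hlt, ?_, ?_, fun k => ?_, fun k => ?_,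
    fun k => ⟨T, fun t ht => ?_⟩⟩
  · have := hPK.trans (Nat.mul_le_mul_right K (Nat.add_le_add_right hlen 1))
    nlinarith
  · simpa [lassoIdx_of_lt (show 0 < m + P by omega)] using hpath.1
  · simp only [lassoIdx_of_lt (lassoIdx_lt hlt k)]
  · have hi := lassoIdx_lt hlt k
    have := hpath.2.2 _ hi
    simp only [lassoIdx_succ hlt k]
    split_ifs with h1
    · exact this
    · rwa [show lassoIdx m (m + P) k + 1 = m + P by omega, hpath.2.1, ← hm] at this
  · obtain ⟨i, hi, he⟩ := hvis (x t) (by simpa using hT t ht)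
    -- Go round the loop `k` times before reading off position `m + i`.
    have hper : ∀ j, lassoIdx m (m + P) (m + i + j * P) = m + i := by
      intro j
      induction j with
      | zero => simpa using lassoIdx_of_lt (by omega)
      | succ j ih =>
        rw [show m + i + (j + 1) * P = m + i + j * P + (m + P - m) by
          rw [Nat.add_sub_cancel_left]; ring, lassoIdx_add_period (by omega), ih]
    refine ⟨m + i + k * P, ?_, ?_⟩
    · have := Nat.le_mul_of_pos_right k hP0
      omega
    · simp only [hper]
      simp [hh, he]

end Pumping

/-! ### The closure of a formula -/

theorem sat_untl_succ {n : ℕ} (w : Trace n) (t a : ℕ) (b : ℕ∞) (φ ψ : Formula n) :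
    Sat w t (.untl (a + 1) b φ ψ) ↔
      b ≠ 0 ∧ Sat w t φ ∧ Sat w (t + 1) (.untl a (b - 1) φ ψ) := by
  simp only [Sat]
  induction b using ENat.recTopCoe with
  | top =>
    simp only [add_top, le_top, true_and, ENat.top_sub_one, ne_eq, ENat.top_ne_zero,
      not_false_eq_true]
    constructor
    · rintro ⟨t', h1, h2, h3⟩
      exact ⟨h3 t le_rfl (by omega), t', by omega, h2, fun s hs => h3 s (by omega)⟩
    · rintro ⟨h0, t', h1, h2, h3⟩
      refine ⟨t', by omega, h2, fun s hs hs' => ?_⟩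
      rcases hs.eq_or_lt with rfl | hs
      · exact h0
      · exact h3 s hs hs'
  | coe b =>
    norm_cast
    constructor
    · rintro ⟨t', h1, hb, h2, h3⟩
      exact ⟨by omega, h3 t le_rfl (by omega), t', by omega, by omega, h2,
        fun s hs => h3 s (by omega)⟩
    · rintro ⟨hb0, h0, t', h1, hb, h2, h3⟩
      refine ⟨t', by omega, by omega, h2, fun s hs hs' => ?_⟩
      rcases hs.eq_or_lt with rfl | hs
      · exact h0
      · exact h3 s hs hs'

theorem sat_untl_zero {n : ℕ} (w : Trace n) (t : ℕ) (b : ℕ∞) (φ ψ : Formula n) :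
    Sat w t (.untl 0 b φ ψ) ↔
      Sat w t ψ ∨ b ≠ 0 ∧ Sat w t φ ∧ Sat w (t + 1) (.untl 0 (b - 1) φ ψ) := by
  rw [← sat_untl_succ w t 0 b φ ψ]
  simp only [Sat]
  constructor
  · rintro ⟨t', h1, hb, h2, h3⟩
    rcases (show t ≤ t' by omega).eq_or_lt with rfl | h
    · exact Or.inl h2
    · exact Or.inr ⟨t', by omega, hb, h2, h3⟩
  · rintro (h | ⟨t', h1, hb, h2, h3⟩)
    · exact ⟨t, by omega, le_self_add, h, fun s hs hs' => by omega⟩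
    · exact ⟨t', by omega, hb, h2, h3⟩

/-- The closure of a formula: its subformulae, and for a timed until also the formulae obtained by
lowering its bounds. An infinite upper bound has `toNat` zero and is never lowered. -/
def Formula.closure {n : ℕ} : Formula n → List (Formula n)
  | .top => [.top]
  | .nonneg i => [.nonneg i]
  | .neg φ => .neg φ :: φ.closure
  | .and φ ψ => .and φ ψ :: (φ.closure ++ ψ.closure)
  | .untl a b φ ψ =>
      ((List.range (a + 1)).flatMap fun i => (List.range (b.toNat + 1)).map
        fun j => .untl i (b - (j : ℕ∞)) φ ψ) ++ (φ.closure ++ ψ.closure)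

/-- Closure under the formulae on which the truth of a formula at one tick depends, at that tick or
at the next. -/
structure IsClosed {n : ℕ} (S : Set (Formula n)) : Prop where
  neg : ∀ {φ}, .neg φ ∈ S → φ ∈ S
  and_left : ∀ {φ ψ}, .and φ ψ ∈ S → φ ∈ S
  and_right : ∀ {φ ψ}, .and φ ψ ∈ S → ψ ∈ S
  untl_left : ∀ {a b φ ψ}, .untl a b φ ψ ∈ S → φ ∈ S
  untl_right : ∀ {a b φ ψ}, .untl a b φ ψ ∈ S → ψ ∈ S
  untl_pred : ∀ {a b φ ψ}, .untl a b φ ψ ∈ S → .untl (a - 1) (b - 1) φ ψ ∈ S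

theorem Formula.self_mem_closure {n : ℕ} (φ : Formula n) : φ ∈ φ.closure := by
  cases φ with
  | untl a b φ ψ =>
    simp only [closure, List.mem_append, List.mem_flatMap, List.mem_map]
    exact Or.inl ⟨a, by simp, 0, by simp, by simp⟩
  | _ => simp [closure]

theorem IsClosed.union {n : ℕ} {S T : Set (Formula n)} (hS : IsClosed S) (hT : IsClosed T) :
    IsClosed (S ∪ T) where
  neg h := h.imp hS.neg hT.neg
  and_left h := h.imp hS.and_left hT.and_left
  and_right h := h.imp hS.and_right hT.and_right
  untl_left h := h.imp hS.untl_left hT.untl_left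
  untl_right h := h.imp hS.untl_right hT.untl_right
  untl_pred h := h.imp hS.untl_pred hT.untl_pred

theorem Formula.isClosed_closure {n : ℕ} (φ : Formula n) : IsClosed {χ | χ ∈ φ.closure} := by
  induction φ with
  | top => constructor <;> simp [closure]
  | nonneg i => constructor <;> simp [closure]
  | neg φ ih =>
    have h := φ.self_mem_closure
    constructor <;> intros <;> simp_all only [closure, Set.mem_ofPred_eq, List.mem_cons, reduceCtorEq,
      false_or, Formula.neg.injEq]
    · rename_i h'
      rcases h' with rfl | h'
      · exact Or.inr h
      · exact Or.inr (ih.neg h')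
    · exact Or.inr (ih.and_left (by assumption))
    · exact Or.inr (ih.and_right (by assumption))
    · exact Or.inr (ih.untl_left (by assumption))
    · exact Or.inr (ih.untl_right (by assumption))
    · exact ih.untl_pred (by assumption)
  | and φ ψ ih₁ ih₂ =>
    have h₁ := φ.self_mem_closure
    have h₂ := ψ.self_mem_closure
    have ih := ih₁.union ih₂
    have e : ∀ χ, χ ∈ (Formula.and φ ψ).closure ↔
        χ = .and φ ψ ∨ χ ∈ {χ | χ ∈ φ.closure} ∪ {χ | χ ∈ ψ.closure} := by
      simp [closure]
    simp only [e]
    refine ⟨fun h => ?_, fun h => ?_, fun h => ?_, fun h => ?_, fun h => ?_, fun h => ?_⟩ <;>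
      rcases h with h | h
    · cases h
    · exact Or.inr (ih.neg h)
    · cases h
      exact Or.inr (Or.inl h₁)
    · exact Or.inr (ih.and_left h)
    · cases h
      exact Or.inr (Or.inr h₂)
    · exact Or.inr (ih.and_right h)
    · cases h
    · exact Or.inr (ih.untl_left h)
    · cases h
    · exact Or.inr (ih.untl_right h)
    · cases h
    · exact Or.inr (ih.untl_pred h)
  | untl a b φ ψ ih₁ ih₂ =>
    have h₁ := φ.self_mem_closure
    have h₂ := ψ.self_mem_closure
    have ih := ih₁.union ih₂
    have e : ∀ χ, χ ∈ (Formula.untl a b φ ψ).closure ↔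
        (∃ i ≤ a, ∃ j ≤ b.toNat, χ = .untl i (b - (j : ℕ∞)) φ ψ) ∨
          χ ∈ {χ | χ ∈ φ.closure} ∪ {χ | χ ∈ ψ.closure} := by
      intro χ
      simp only [closure, List.mem_append, List.mem_flatMap, List.mem_map, List.mem_range,
        Order.lt_add_one_iff, Set.mem_union, Set.mem_ofPred_eq, eq_comm (a := χ)]
    simp only [e]
    refine ⟨fun h => ?_, fun h => ?_, fun h => ?_, fun h => ?_, fun h => ?_, fun h => ?_⟩ <;>
      rcases h with ⟨i, hi, j, hj, h⟩ | h
    · cases h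
    · exact Or.inr (ih.neg h)
    · cases h
    · exact Or.inr (ih.and_left h)
    · cases h
    · exact Or.inr (ih.and_right h)
    · cases h
      exact Or.inr (Or.inl h₁)
    · exact Or.inr (ih.untl_left h)
    · cases h
      exact Or.inr (Or.inr h₂)
    · exact Or.inr (ih.untl_right h)
    · cases h
      rename_i i
      left
      induction b using ENat.recTopCoe with
      | top => exact ⟨i - 1, by omega, 0, by simp, by simp⟩
      | coe b =>
        simp only [ENat.toNat_natCast] at hj ⊢
        refine ⟨i - 1, by omega, min (j + 1) b, by omega, ?_⟩
        congr 1
        norm_cast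
        omega
    · exact Or.inr (ih.untl_pred h)

/-- The number of formulae that a token contributes to the closure, or an upper bound of it. -/
def tokenWeight (c : Token) : ℕ :=
  (c.2.1 + 1) * (c.2.2.getD 0 + 1)

theorem Formula.length_closure_le {n : ℕ} (φ : Formula n) :
    φ.closure.length ≤ (φ.encode.map tokenWeight).sum := by
  induction φ with
  | top => simp [closure, encode, tokenWeight]
  | nonneg i => simp [closure, encode, tokenWeight]
  | neg φ ih => simpa [closure, encode, tokenWeight] using ih
  | and φ ψ ih₁ ih₂ =>
    simp [closure, encode, tokenWeight]
    omega
  | untl a b φ ψ ih₁ ih₂ =>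
    have : (b.recTopCoe none some : Option ℕ).getD 0 = b.toNat := by
      induction b using ENat.recTopCoe <;> simp
    simp [closure, encode, tokenWeight, this, List.length_flatMap]
    omega

/-! ### Reduction to lassos -/

/-- Truth of the formulae of a closed set is determined by local consistency together with the
fulfilment of unbounded untils. Here `g` sends the ticks of `w'` to ticks of `w` so that the steps
of `w'` look like steps of `w`; by `hfair` what holds from some tick of `w'` on holds in `w` at all
large ticks, so that no unbounded until is postponed forever along `w'`. -/
theorem sat_iff_of_simulation {n : ℕ} {S : Set (Formula n)} (hS : IsClosed S) {w w' : Trace n}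
    {g : ℕ → ℕ} (hw : ∀ k, w' k = w (g k))
    (hstep : ∀ k, ∀ χ ∈ S, Sat w (g k + 1) χ ↔ Sat w (g (k + 1)) χ)
    (hfair : ∀ k, ∃ T, ∀ t ≥ T, ∃ k' ≥ k, ∀ χ ∈ S, Sat w t χ ↔ Sat w (g k') χ) (χ : Formula n) :
    χ ∈ S → ∀ k, Sat w' k χ ↔ Sat w (g k) χ := by
  induction χ with
  | top => intro _ k; rfl
  | nonneg i => intro _ k; simp only [Sat, hw]
  | neg φ ih => intro h k; simp only [Sat, ih (hS.neg h)]
  | and φ ψ ih₁ ih₂ => intro h k; simp only [Sat, ih₁ (hS.and_left h), ih₂ (hS.and_right h)]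
  | untl a b φ ψ ih₁ ih₂ =>
    intro h
    replace ih₁ := ih₁ (hS.untl_left h)
    replace ih₂ := ih₂ (hS.untl_right h)
    induction a generalizing b with
    | succ a ih =>
      intro k
      have h' := hS.untl_pred h
      rw [Nat.add_sub_cancel] at h'
      rw [sat_untl_succ, sat_untl_succ, ih₁, ih _ h', hstep k _ h']
    | zero =>
      induction b using ENat.recTopCoe with
      | coe b =>
        induction b with
        | zero =>
          intro k
          rw [sat_untl_zero w', sat_untl_zero w, ih₂]
          simp
        | succ b ih =>
          intro k
          have h' := hS.untl_pred h
          have e : ((b + 1 : ℕ) : ℕ∞) - 1 = b := by norm_cast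
          rw [e] at h'
          rw [sat_untl_zero w', sat_untl_zero w, ih₁, ih₂, e, ih h', hstep k _ h']
      | top =>
        have expand : ∀ (v : Trace n) t, Sat v t (.untl 0 ⊤ φ ψ) ↔
            Sat v t ψ ∨ Sat v t φ ∧ Sat v (t + 1) (.untl 0 ⊤ φ ψ) := by
          intro v t
          rw [sat_untl_zero, ENat.top_sub_one]
          simp only [ne_eq, ENat.top_ne_zero, not_false_eq_true, true_and]
        intro k
        constructor
        · rintro ⟨t', hk, -, hψ, hφ⟩
          obtain ⟨d, rfl⟩ : ∃ d, t' = k + d := ⟨t' - k, by omega⟩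
          induction d generalizing k with
          | zero => exact (expand _ _).2 (Or.inl ((ih₂ k).1 hψ))
          | succ d ih =>
            refine (expand _ _).2 (Or.inr ⟨(ih₁ k).1 (hφ k le_rfl (by omega)), ?_⟩)
            rw [hstep k _ h]
            rw [show k + (d + 1) = k + 1 + d by omega] at hψ hφ
            exact ih (k + 1) (by omega) hψ fun s hs hs' => hφ s (by omega) hs'
        · intro hk
          by_contra hk'
          -- An until that `w'` wrongly lacks is postponed forever along `g`.
          have key : ∀ d, Sat w (g (k + d)) (.untl 0 ⊤ φ ψ) ∧ ¬ Sat w' (k + d) (.untl 0 ⊤ φ ψ) := by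
            intro d
            induction d with
            | zero => exact ⟨hk, hk'⟩
            | succ d ih =>
              obtain ⟨h1, h2⟩ := ih
              rw [expand, ih₁, ih₂] at h2
              rw [expand, hstep _ _ h] at h1
              rw [← add_assoc]
              tauto
          obtain ⟨T, hT⟩ := hfair k
          have hT' : ∀ t ≥ T, Sat w t (.untl 0 ⊤ φ ψ) ∧ ¬ Sat w t ψ := by
            intro t ht
            obtain ⟨k', hk', he⟩ := hT t ht
            obtain ⟨d, rfl⟩ : ∃ d, k' = k + d := ⟨k' - k, by omega⟩
            obtain ⟨h1, h2⟩ := key d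
            rw [expand, ih₂] at h2
            rw [he _ h, he _ (hS.untl_right h)]
            exact ⟨h1, fun h3 => h2 (Or.inl h3)⟩
          obtain ⟨t', ht', -, hψ, -⟩ := (hT' T le_rfl).1
          exact (hT' t' (by omega)).2 hψ

/-- A bound for the length of the lassos that have to be inspected, in terms of the number of
states and of the code of the formula. -/
def lassoBound (N : ℕ) (l : List Token) : ℕ :=
  N * 2 ^ (l.map tokenWeight).sum * (N * 2 ^ (l.map tokenWeight).sum + 2)

theorem System.exists_lasso_run {n : ℕ} (M : System n) (φ : Formula n)
    {ρ : ℕ → Fin M.numStates} (hρ : M.IsRun ρ) :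
    ∃ (p L : ℕ) (ρ' : ℕ → Fin M.numStates), p < L ∧
      L ≤ lassoBound M.numStates φ.encode ∧ M.IsRun ρ' ∧
      (∀ k, ρ' k = ρ' (lassoIdx p L k)) ∧ (Sat (M.trace ρ') 0 φ ↔ Sat (M.trace ρ) 0 φ) := by
  let m := φ.closure.length
  -- The type of a tick: the current state and the closure formulae that hold.
  let x : ℕ → Fin M.numStates × (Fin m → Prop) :=
    fun t => (ρ t, fun i => Sat (M.trace ρ) t (φ.closure.get i))
  have hx : ∀ {s t}, x s = x t → ∀ χ ∈ {χ | χ ∈ φ.closure},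
      Sat (M.trace ρ) s χ ↔ Sat (M.trace ρ) t χ := by
    intro s t h χ hχ
    obtain ⟨i, rfl⟩ := List.mem_iff_get.1 hχ
    exact iff_of_eq (congrFun (congrArg Prod.snd h) i)
  have hcard : Fintype.card (Fin M.numStates × (Fin m → Prop)) ≤
      M.numStates * 2 ^ (φ.encode.map tokenWeight).sum := by
    rw [Fintype.card_prod, Fintype.card_fun, Fintype.card_prop, Fintype.card_fin, Fintype.card_fin]
    exact Nat.mul_le_mul_left _ (Nat.pow_le_pow_right (by norm_num) φ.length_closure_le)
  obtain ⟨p, L, y, hpL, hL, hy0, hyidx, hystep, hyfair⟩ := exists_lasso hcard x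
  choose g hg hg' using hystep
  have hfst : ∀ k, (y k).1 = ρ (g k) := fun k => (congrArg Prod.fst (hg k)).symm
  refine ⟨p, L, fun k => (y k).1, hpL, hL, ⟨?_, fun k => ?_⟩, fun k => congrArg Prod.fst (hyidx k),
    ?_⟩
  · simpa only [hy0] using hρ.1
  · have h1 : (y (k + 1)).1 = ρ (g k + 1) := (congrArg Prod.fst (hg' k)).symm
    simp only [h1, hfst k]
    exact hρ.2 (g k)
  · have h0 : x (g 0) = x 0 := (hg 0).trans hy0
    rw [sat_iff_of_simulation φ.isClosed_closure (w := M.trace ρ) (g := g)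
      (fun k => by funext i; simp [System.trace, hfst])
      (fun k => hx ((hg' k).trans (hg (k + 1)).symm))
      (fun k => ?_) φ φ.self_mem_closure 0]
    · exact hx h0 φ φ.self_mem_closure
    · obtain ⟨T, hT⟩ := hyfair k
      refine ⟨T, fun t ht => ?_⟩
      obtain ⟨k', hk', he⟩ := hT t ht
      exact ⟨k', hk', hx (he.trans (hg k').symm)⟩

/-! ### Evaluation of formulae on lassos -/

/-- Truth at a tick only depends on the trace from that tick on. -/
theorem sat_iff_of_shift {n : ℕ} {w w' : Trace n} {s s' : ℕ} (h : ∀ j, w (s + j) = w' (s' + j))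
    (φ : Formula n) : Sat w s φ ↔ Sat w' s' φ := by
  suffices ∀ j, Sat w (s + j) φ ↔ Sat w' (s' + j) φ from this 0
  induction φ with
  | top => intro j; rfl
  | nonneg i => intro j; simp only [Sat, h]
  | neg φ ih => intro j; simp only [Sat, ih]
  | and φ ψ ih₁ ih₂ => intro j; simp only [Sat, ih₁, ih₂]
  | untl a b φ ψ ih₁ ih₂ =>
    intro j
    have key : ∀ (v : Trace n) (r : ℕ), Sat v (r + j) (.untl a b φ ψ) ↔
        ∃ d : ℕ, a ≤ d ∧ (d : ℕ∞) ≤ b ∧ Sat v (r + (j + d)) ψ ∧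
          ∀ e < d, Sat v (r + (j + e)) φ := by
      intro v r
      constructor
      · rintro ⟨t, h1, h2, h3, h4⟩
        obtain ⟨d, rfl⟩ : ∃ d, t = r + (j + d) := ⟨t - (r + j), by omega⟩
        refine ⟨d, by omega, ?_, h3, fun e he => h4 _ (by omega) (by omega)⟩
        rw [← add_assoc, Nat.cast_add] at h2
        exact (ENat.add_le_add_iff_left (ENat.natCast_ne_top _)).1 h2
      · rintro ⟨d, h1, h2, h3, h4⟩
        refine ⟨r + (j + d), by omega, ?_, h3, fun t ht ht' => ?_⟩
        · rw [← add_assoc, Nat.cast_add]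
          exact add_le_add_right h2 _
        · obtain ⟨e, rfl⟩ : ∃ e, t = r + (j + e) := ⟨t - (r + j), by omega⟩
          exact h4 e (by omega)
    simp only [key, ih₁, ih₂]

/-- On a lasso the witness of an until can be found within one traversal of the lasso. -/
theorem sat_untl_iff_of_lasso {n : ℕ} {w : Trace n} {p L : ℕ} (hpL : p < L)
    (hw : ∀ k, w k = w (lassoIdx p L k)) (k a : ℕ) (b : ℕ∞) (φ ψ : Formula n) :
    Sat w k (.untl a b φ ψ) ↔ ∃ t < k + a + L + 1, k + a ≤ t ∧ (t : ℕ∞) ≤ (k : ℕ∞) + b ∧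
      Sat w t ψ ∧ ∀ s < t, k ≤ s → Sat w s φ := by
  classical
  constructor
  · intro h
    have h' : ∃ t : ℕ, k + a ≤ t ∧ (t : ℕ∞) ≤ (k : ℕ∞) + b ∧ Sat w t ψ ∧
        ∀ s : ℕ, k ≤ s → s < t → Sat w s φ := h
    obtain ⟨h1, h2, h3, h4⟩ := Nat.find_spec h'
    refine ⟨Nat.find h', ?_, h1, h2, h3, fun s hs hs' => h4 s hs' hs⟩
    by_contra hlt
    -- A later first witness could be moved back by one period of the loop.
    refine Nat.find_min h' (m := Nat.find h' - (L - p)) (by omega) ⟨by omega, ?_, ?_,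
      fun s hs hs' => h4 s hs (by omega)⟩
    · exact le_trans (by exact_mod_cast Nat.sub_le _ _) h2
    · refine (sat_iff_of_shift (fun j => ?_) ψ).1 h3
      rw [hw, hw (Nat.find h' - (L - p) + j),
        show Nat.find h' + j = Nat.find h' - (L - p) + j + (L - p) by omega,
        lassoIdx_add_period (by omega)]
  · rintro ⟨t, -, h1, h2, h3, h4⟩
    exact ⟨t, h1, h2, h3, fun s hs hs' => h4 s hs' hs⟩

/-- The data on which the evaluation of a formula on a lasso depends: the matrix of the signal
values of the states, the list of the states on the lasso, and the position to which the lasso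
returns. -/
abbrev LassoCode : Type := List (List (ℤ × ℕ)) × List ℕ × ℕ

/-- The truth value at position `k` of the formula whose last token is `c`, computed from the truth
tables of its immediate subformulae, which are on top of the stack `st`. -/
def HoldsAt (e : LassoCode) (st : List (List Bool)) (c : Token) (k : ℕ) : Prop :=
  c.1 = 0 ∨
  (c.1 = 1 ∧ 0 ≤ ((e.1.getD (e.2.1.getD k 0) []).getD c.2.1 (0, 0)).1) ∨
  (c.1 = 2 ∧ (st.getD 0 []).getD k false = false) ∨
  (c.1 = 3 ∧ (st.getD 1 []).getD k false = true ∧ (st.getD 0 []).getD k false = true) ∨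
  (c.1 = 4 ∧ ∃ t < k + c.2.1 + e.2.1.length + 1, k + c.2.1 ≤ t ∧
    (c.2.2 = none ∨ t ≤ k + c.2.2.getD 0) ∧
    (st.getD 0 []).getD (lassoIdx e.2.2 e.2.1.length t) false = true ∧
    ∀ s < t, k ≤ s → (st.getD 1 []).getD (lassoIdx e.2.2 e.2.1.length s) false = true)

/-- The number of immediate subformulae of a formula, in terms of the tag of its last token. -/
def arity (tag : ℕ) : ℕ :=
  if tag = 2 then 1 else if tag = 3 ∨ tag = 4 then 2 else 0

open Classical in
/-- One step of a stack machine that reads a formula in reverse Polish notation and replaces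
formulae by their truth tables along a lasso. -/
noncomputable def evalStep (e : LassoCode) (st : List (List Bool)) (c : Token) :
    List (List Bool) :=
  (List.range e.2.1.length).map (fun k => decide (HoldsAt e st c k)) :: st.drop (arity c.1)

open Classical in
/-- The truth table of a formula at the ticks `0, …, L - 1`. -/
noncomputable def truthTable {n : ℕ} (w : Trace n) (L : ℕ) (φ : Formula n) : List Bool :=
  (List.range L).map fun k => decide (Sat w k φ)

theorem getD_truthTable {n : ℕ} (w : Trace n) {L k : ℕ} (hk : k < L) (φ : Formula n) :
    (truthTable w L φ).getD k false = true ↔ Sat w k φ := by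
  simp [truthTable, List.getD_eq_getElem?_getD, hk]

theorem getD_truthTable_lassoIdx {n : ℕ} {w : Trace n} {p L : ℕ} (hpL : p < L)
    (hw : ∀ k, w k = w (lassoIdx p L k)) (k : ℕ) (φ : Formula n) :
    (truthTable w L φ).getD (lassoIdx p L k) false = true ↔ Sat w k φ := by
  rw [getD_truthTable w (lassoIdx_lt hpL k)]
  refine sat_iff_of_shift (fun j => ?_) φ
  rw [hw, hw (k + j), lassoIdx_lassoIdx_add hpL]

theorem evalStep_eq {n : ℕ} {w : Trace n} {e : LassoCode} {st st' : List (List Bool)} {c : Token}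
    {φ : Formula n} (h : ∀ k < e.2.1.length, HoldsAt e st c k ↔ Sat w k φ)
    (hst : st.drop (arity c.1) = st') :
    evalStep e st c = truthTable w e.2.1.length φ :: st' := by
  classical
  unfold evalStep truthTable
  rw [hst]
  congr 1
  refine List.map_congr_left fun k hk => ?_
  simp only [h k (List.mem_range.1 hk)]

/-- The stack machine computes truth tables. -/
theorem foldl_evalStep_encode {n : ℕ} {w : Trace n} {e : LassoCode} (hp : e.2.2 < e.2.1.length)
    (hw : ∀ k, w k = w (lassoIdx e.2.2 e.2.1.length k))
    (hval : ∀ k < e.2.1.length, ∀ i : Fin n,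
      0 ≤ ((e.1.getD (e.2.1.getD k 0) []).getD i (0, 0)).1 ↔ 0 ≤ w k i) (φ : Formula n) :
    ∀ st, φ.encode.foldl (evalStep e) st = truthTable w e.2.1.length φ :: st := by
  induction φ with
  | top =>
    intro st
    exact evalStep_eq (fun k _ => by simp [HoldsAt, Sat]) (by simp [arity])
  | nonneg i =>
    intro st
    refine evalStep_eq (fun k hk => ?_) (by simp [arity])
    have := hval k hk i
    simp only [HoldsAt, Sat]
    simpa using this
  | neg φ ih =>
    intro st
    rw [Formula.encode, List.foldl_append, ih]
    refine evalStep_eq (fun k hk => ?_) (by simp [arity])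
    have := getD_truthTable w hk φ
    simp only [HoldsAt, Sat, ← this]
    simp
  | and φ ψ ih₁ ih₂ =>
    intro st
    rw [Formula.encode, List.foldl_append, List.foldl_append, ih₁, ih₂]
    refine evalStep_eq (fun k hk => ?_) (by simp [arity])
    have h₁ := getD_truthTable w hk φ
    have h₂ := getD_truthTable w hk ψ
    simp only [HoldsAt, Sat, ← h₁, ← h₂]
    simp
  | untl a b φ ψ ih₁ ih₂ =>
    intro st
    rw [Formula.encode, List.foldl_append, List.foldl_append, ih₁, ih₂]
    refine evalStep_eq (fun k hk => ?_) (by simp [arity])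
    rw [sat_untl_iff_of_lasso hp hw]
    have hb : ∀ t : ℕ, ((b.recTopCoe none some : Option ℕ) = none ∨
        t ≤ k + (b.recTopCoe none some : Option ℕ).getD 0) ↔ (t : ℕ∞) ≤ (k : ℕ∞) + b := by
      intro t
      induction b using ENat.recTopCoe with
      | top => simp
      | coe b =>
        simp only [ENat.recTopCoe_natCast, reduceCtorEq, false_or, Option.getD_some]
        norm_cast
    simp only [HoldsAt, List.getD_cons_zero, List.getD_cons_succ, hb,
      getD_truthTable_lassoIdx hp hw]
    simp

/-! ### The decision procedure -/

/-- The lists of length `L` with entries below `N`. -/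
def words (N : ℕ) : ℕ → List (List ℕ)
  | 0 => [[]]
  | L + 1 => (words N L).flatMap fun l => (List.range N).map fun s => s :: l

theorem mem_words {N L : ℕ} {l : List ℕ} :
    l ∈ words N L ↔ l.length = L ∧ ∀ s ∈ l, s < N := by
  induction L generalizing l with
  | zero =>
    simp only [words, List.mem_singleton, List.length_eq_zero_iff]
    constructor
    · rintro rfl
      simp
    · exact And.left
  | succ L ih =>
    simp only [words, List.mem_flatMap, List.mem_map, List.mem_range, ih]
    constructor
    · rintro ⟨l, ⟨rfl, hl⟩, s, hs, rfl⟩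
      simpa using ⟨hs, hl⟩
    · rintro ⟨h, hl⟩
      cases l with
      | nil => simp at h
      | cons s l => exact ⟨l, ⟨by simpa using h, fun u hu => hl u (by simp [hu])⟩, s,
          hl s (by simp), rfl⟩

/-- The lasso through the states in `l` that returns from the last of them to position `p` is a run
of the system with initial flags `ini` and transition matrix `tr`. -/
def IsLassoRun (ini : List Bool) (tr : List (List Bool)) (l : List ℕ) (p : ℕ) : Prop :=
  ini.getD (l.getD 0 0) false = true ∧ ∀ k < l.length,
    (tr.getD (l.getD k 0) []).getD (l.getD (lassoIdx p l.length (k + 1)) 0) false = true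

/-- The formula evaluates to true at the start of every lasso run up to the critical length. -/
def Accepts (c : Code) : Prop :=
  ∀ L < lassoBound c.2.1.1 c.2.2 + 1, ∀ l ∈ words c.2.1.1 L, ∀ p < L,
    IsLassoRun c.2.1.2.1 c.2.1.2.2.1 l p →
      ((c.2.2.foldl (evalStep (c.2.1.2.2.2, l, p)) []).getD 0 []).getD 0 false = true

theorem getD_ofFn {α : Type*} {N : ℕ} (f : Fin N → α) (i : Fin N) (d : α) :
    (List.ofFn f).getD i d = f i := by
  simp [List.getD_eq_getElem?_getD]

/-- The tests performed on a list of states agree with the semantics of the lasso it describes. -/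
theorem isLassoRun_and_eval_iff {n : ℕ} (M : System n) (φ : Formula n) {p : ℕ} {l : List ℕ}
    (hp : p < l.length) {ρ : ℕ → Fin M.numStates} (hρ : ∀ k, ρ k = ρ (lassoIdx p l.length k))
    (hl : ∀ k < l.length, l.getD k 0 = ρ k) :
    (IsLassoRun (List.ofFn M.init) (List.ofFn fun s => List.ofFn (M.trans s)) l p ↔ M.IsRun ρ) ∧
    (((φ.encode.foldl (evalStep (List.ofFn fun s => List.ofFn fun i =>
      ((M.value s i).num, (M.value s i).den), l, p)) []).getD 0 []).getD 0 false = true ↔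
        Sat (M.trace ρ) 0 φ) := by
  have hl' : ∀ k, l.getD (lassoIdx p l.length k) 0 = ρ k := by
    intro k
    rw [hl _ (lassoIdx_lt hp k), ← hρ]
  constructor
  · simp only [IsLassoRun, System.IsRun, hl 0 (by omega), getD_ofFn, hl']
    refine and_congr_right fun _ => ⟨fun h k => ?_, fun h k hk => ?_⟩
    · have := h _ (lassoIdx_lt hp k)
      have hsucc : ρ (lassoIdx p l.length k + 1) = ρ (k + 1) := by
        rw [hρ, lassoIdx_lassoIdx_add hp, ← hρ]
      rwa [hl', getD_ofFn, getD_ofFn, hsucc] at this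
    · rw [hl k hk, getD_ofFn, getD_ofFn]
      exact h k
  · rw [foldl_evalStep_encode (w := M.trace ρ) hp, List.getD_cons_zero,
      getD_truthTable _ (show 0 < _ by simp only; omega)]
    · intro k
      funext i
      simp only [System.trace]
      rw [hρ k]
    · intro k hk i
      simp only at hk ⊢
      rw [hl k hk, getD_ofFn, getD_ofFn]
      simp only [System.trace, Rat.num_nonneg, Rat.cast_nonneg]

theorem accepts_encode_iff (I : Instance) :
    Accepts I.encode ↔ I.system.Satisfies I.formula := by
  obtain ⟨n, M, φ⟩ := I
  simp only [Accepts, Instance.encode, System.encode]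
  constructor
  · intro h ρ hρ
    obtain ⟨p, L, ρ', hpL, hL, hrun, hidx, hsat⟩ := M.exists_lasso_run φ hρ
    rw [← hsat]
    let l := List.ofFn fun k : Fin L => (ρ' k : ℕ)
    have hlen : l.length = L := List.length_ofFn
    obtain ⟨h1, h2⟩ := isLassoRun_and_eval_iff M φ (p := p) (l := l) (ρ := ρ')
      (by omega) (by rwa [hlen]) fun k hk => getD_ofFn (fun k : Fin L => (ρ' k : ℕ))
        ⟨k, hlen ▸ hk⟩ 0
    refine h2.1 (h L (by omega) l (mem_words.2 ⟨hlen, ?_⟩) p hpL (h1.2 hrun))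
    intro s hs
    obtain ⟨k, rfl⟩ := (List.mem_ofFn' _ _).1 hs
    exact (ρ' k).2
  · intro h L _ l hl p hp hrun
    obtain ⟨rfl, hlN⟩ := mem_words.1 hl
    have hmem : ∀ k, l.getD (lassoIdx p l.length k) 0 < M.numStates := by
      intro k
      have hk := lassoIdx_lt hp k
      rw [List.getD_eq_getElem _ _ hk]
      exact hlN _ (List.getElem_mem hk)
    obtain ⟨h1, h2⟩ := isLassoRun_and_eval_iff M φ hp (ρ := fun k => ⟨_, hmem k⟩)
      (fun k => by simp only [lassoIdx_of_lt (lassoIdx_lt hp k)])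
      (fun k hk => by simp only [lassoIdx_of_lt hk])
    exact h2.2 (h _ (h1.1 hrun))

/-! ### Recognition of codes -/

/-- The tokens that occur in codes of formulae over `n` signals. -/
def IsToken (n : ℕ) (c : Token) : Prop :=
  c = (0, 0, none) ∨ (c.1 = 1 ∧ c.2.1 < n ∧ c.2.2 = none) ∨ c = (2, 0, none) ∨ c = (3, 0, none) ∨
    c.1 = 4

open Classical in
/-- One step of the computation of the height of the stack while a formula is read. The value
`h + 1` stands for height `h`, and `0` for an error. -/
noncomputable def heightStep (n h : ℕ) (c : Token) : ℕ :=
  if IsToken n c ∧ arity c.1 < h then h - arity c.1 + 1 else 0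

theorem foldl_heightStep_encode {n : ℕ} (φ : Formula n) :
    ∀ h, φ.encode.foldl (heightStep n) (h + 1) = h + 2 := by
  induction φ with
  | top => simp [Formula.encode, heightStep, IsToken, arity]
  | nonneg i => simp [Formula.encode, heightStep, IsToken, arity]
  | neg φ ih => simp [Formula.encode, heightStep, IsToken, arity, ih]
  | and φ ψ ih₁ ih₂ =>
    intro h
    simp [Formula.encode, heightStep, IsToken, arity, ih₁, ih₂ (h + 1)]
  | untl a b φ ψ ih₁ ih₂ =>
    intro h
    simp [Formula.encode, heightStep, IsToken, arity, ih₁, ih₂ (h + 1)]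

/-- A list of tokens that can be read without error is a concatenation of codes of formulae. The last
formula is on top of the stack, so the stack is reversed in the concatenation. -/
theorem exists_formulas_of_foldl_heightStep {n : ℕ} (l : List Token) :
    ∀ h, l.foldl (heightStep n) 1 = h + 1 →
      ∃ fs : List (Formula n), fs.length = h ∧ (fs.reverse.map Formula.encode).flatten = l := by
  induction l using List.reverseRecOn with
  | nil =>
    intro h hh
    exact ⟨[], Nat.succ.inj hh, rfl⟩
  | append_singleton l c ih =>
    intro h hh
    rw [List.foldl_append, List.foldl_cons, List.foldl_nil] at hh
    generalize l.foldl (heightStep n) 1 = m at hh ih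
    unfold heightStep at hh
    split_ifs at hh with hc
    obtain ⟨hc, hm⟩ := hc
    obtain ⟨fs, hfs, rfl⟩ := ih (m - 1) (by omega)
    obtain ⟨tag, a, b⟩ := c
    rcases hc with hc | ⟨h1, h2, h3⟩ | hc | hc | hc
    · cases hc
      refine ⟨.top :: fs, ?_, by simp [Formula.encode]⟩
      simp [arity] at hh hm ⊢
      omega
    · simp only at h1 h2 h3
      subst h1 h3
      refine ⟨.nonneg ⟨a, h2⟩ :: fs, ?_, by simp [Formula.encode]⟩
      simp [arity] at hh hm ⊢
      omega
    · cases hc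
      simp [arity] at hh hm
      obtain ⟨φ, fs, rfl⟩ := List.exists_cons_of_length_pos (l := fs) (by omega)
      refine ⟨.neg φ :: fs, ?_, by simp [Formula.encode]⟩
      simp at hfs ⊢
      omega
    · cases hc
      simp [arity] at hh hm
      obtain ⟨ψ, fs, rfl⟩ := List.exists_cons_of_length_pos (l := fs) (by omega)
      obtain ⟨φ, fs, rfl⟩ := List.exists_cons_of_length_pos (l := fs) (by simp at hfs; omega)
      refine ⟨.and φ ψ :: fs, ?_, by simp [Formula.encode]⟩
      simp at hfs ⊢
      omega
    · simp only at hc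
      subst hc
      simp [arity] at hh hm
      obtain ⟨ψ, fs, rfl⟩ := List.exists_cons_of_length_pos (l := fs) (by omega)
      obtain ⟨φ, fs, rfl⟩ := List.exists_cons_of_length_pos (l := fs) (by simp at hfs; omega)
      obtain ⟨b, rfl⟩ : ∃ b' : ℕ∞, b'.recTopCoe none some = b := by
        cases b with
        | none => exact ⟨⊤, rfl⟩
        | some b => exact ⟨b, rfl⟩
      refine ⟨.untl a b φ ψ :: fs, ?_, by simp [Formula.encode]⟩
      simp at hfs ⊢
      omega

theorem exists_formula_encode_iff {n : ℕ} {l : List Token} :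
    (∃ φ : Formula n, φ.encode = l) ↔ l.foldl (heightStep n) 1 = 2 := by
  constructor
  · rintro ⟨φ, rfl⟩
    exact foldl_heightStep_encode φ 0
  · intro h
    obtain ⟨fs, hfs, rfl⟩ := exists_formulas_of_foldl_heightStep l 1 h
    obtain ⟨φ, rfl⟩ := List.length_eq_one_iff.1 hfs
    exact ⟨φ, by simp⟩

/-- The codes of systems with `n` signals. -/
def IsSystemCode (n : ℕ) (c : SystemCode) : Prop :=
  c.2.1.length = c.1 ∧ c.2.2.1.length = c.1 ∧ (∀ r ∈ c.2.2.1, r.length = c.1) ∧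
    c.2.2.2.length = c.1 ∧
      ∀ r ∈ c.2.2.2, r.length = n ∧ ∀ q ∈ r, q.2 ≠ 0 ∧ q.1.natAbs.Coprime q.2

theorem exists_ofFn {α : Type*} {N : ℕ} {l : List α} (h : l.length = N) :
    ∃ f : Fin N → α, List.ofFn f = l := by
  subst h
  exact ⟨l.get, List.ofFn_get l⟩

theorem exists_system_encode_iff {n : ℕ} {c : SystemCode} :
    (∃ M : System n, M.encode = c) ↔ IsSystemCode n c := by
  constructor
  · rintro ⟨M, rfl⟩
    refine ⟨by simp [System.encode], by simp [System.encode], ?_, by simp [System.encode], ?_⟩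
    · simp [System.encode, List.mem_ofFn']
    · simp only [System.encode, List.forall_mem_ofFn_iff]
      exact fun s => ⟨by simp, fun i => ⟨(M.value s i).den_nz, (M.value s i).reduced⟩⟩
  · obtain ⟨N, ini, tr, vals⟩ := c
    rintro ⟨h1, h2, h3, h4, h5⟩
    simp only at h1 h2 h3 h4 h5
    obtain ⟨ini, rfl⟩ := exists_ofFn h1
    obtain ⟨tr, rfl⟩ := exists_ofFn h2
    obtain ⟨vals, rfl⟩ := exists_ofFn h4
    rw [List.forall_mem_ofFn_iff] at h3 h5
    choose tr' htr using fun s => exists_ofFn (h3 s)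
    choose vals' hvals using fun s => exists_ofFn (h5 s).1
    have hq : ∀ s i, ∃ q : ℚ, (q.num, q.den) = vals' s i := by
      intro s i
      have := (h5 s).2
      rw [← hvals s, List.forall_mem_ofFn_iff] at this
      exact ⟨⟨(vals' s i).1, (vals' s i).2, (this i).1, (this i).2⟩, rfl⟩
    choose value hvalue using hq
    exact ⟨⟨N, ini, tr', value⟩, by simp [System.encode, htr, hvalue, hvals]⟩

theorem exists_instance_encode_iff {c : Code} :
    (∃ I : Instance, I.encode = c ∧ I.system.Satisfies I.formula) ↔
      IsSystemCode c.1 c.2.1 ∧ c.2.2.foldl (heightStep c.1) 1 = 2 ∧ Accepts c := by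
  constructor
  · rintro ⟨I, rfl, h⟩
    exact ⟨exists_system_encode_iff.1 ⟨I.system, rfl⟩,
      exists_formula_encode_iff.1 ⟨I.formula, rfl⟩, (accepts_encode_iff I).2 h⟩
  · rintro ⟨h1, h2, h3⟩
    obtain ⟨n, s, l⟩ := c
    simp only at h1 h2
    obtain ⟨M, rfl⟩ := exists_system_encode_iff.2 h1
    obtain ⟨φ, rfl⟩ := exists_formula_encode_iff.2 h2
    exact ⟨⟨n, M, φ⟩, rfl, (accepts_encode_iff ⟨n, M, φ⟩).1 h3⟩

/-! ### Primitive recursiveness -/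

section Primrec

open Primrec

variable {α β : Type*} [Primcodable α] [Primcodable β]

theorem primrecPred_exists_mem {f : α → List β} {R : α → β → Prop} (hf : Primrec f)
    (hR : PrimrecRel R) : PrimrecPred fun a => ∃ b ∈ f a, R a b :=
  hR.swap.exists_mem_list.comp hf Primrec.id

theorem primrecPred_forall_mem {f : α → List β} {R : α → β → Prop} (hf : Primrec f)
    (hR : PrimrecRel R) : PrimrecPred fun a => ∀ b ∈ f a, R a b :=
  hR.swap.forall_mem_list.comp hf Primrec.id

theorem primrecPred_exists_lt {f : α → ℕ} {R : α → ℕ → Prop} (hf : Primrec f)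
    (hR : PrimrecRel R) : PrimrecPred fun a => ∃ k < f a, R a k :=
  (primrecPred_exists_mem (list_range.comp hf) hR).of_eq (by simp)

theorem primrecPred_forall_lt {f : α → ℕ} {R : α → ℕ → Prop} (hf : Primrec f)
    (hR : PrimrecRel R) : PrimrecPred fun a => ∀ k < f a, R a k :=
  (primrecPred_forall_mem (list_range.comp hf) hR).of_eq (by simp)

theorem primrecPred_imp {p q : α → Prop} (hp : PrimrecPred p) (hq : PrimrecPred q) :
    PrimrecPred fun a => p a → q a :=
  (hp.not.or hq).of_eq fun _ => imp_iff_not_or.symm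

theorem primrecPred_eq_const {f : α → β} (hf : Primrec f) (b : β) :
    PrimrecPred fun a => f a = b :=
  Primrec.eq.comp hf (const b)

theorem primrec_getD {f : α → List β} {k : α → ℕ} (hf : Primrec f) (hk : Primrec k) (d : β) :
    Primrec fun a => (f a).getD (k a) d :=
  (list_getD d).comp hf hk

theorem primrec_natAbs : Primrec Int.natAbs := by
  -- The code of `m` is `2 * m`, and the code of `-(m + 1)` is `2 * m + 1`.
  have h : Primrec fun z : ℤ => (Encodable.encode z + 1) / 2 :=
    nat_div.comp (succ.comp Primrec.encode) (const 2)
  refine h.of_eq fun z => ?_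
  cases z with
  | ofNat m =>
    change (2 * m + 1) / 2 = m
    omega
  | negSucc m =>
    change (2 * m + 1 + 1) / 2 = m + 1
    omega

theorem primrecPred_int_nonneg : PrimrecPred fun z : ℤ => 0 ≤ z := by
  have h : PrimrecPred fun z : ℤ => Encodable.encode z % 2 = 0 :=
    primrecPred_eq_const (nat_mod.comp Primrec.encode (const 2)) 0
  refine h.of_eq fun z => ?_
  cases z with
  | ofNat m =>
    change 2 * m % 2 = 0 ↔ 0 ≤ (m : ℤ)
    omega
  | negSucc m =>
    change (2 * m + 1) % 2 = 0 ↔ _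
    simp only [Int.negSucc_not_nonneg, iff_false]
    omega

theorem primrecRel_dvd : PrimrecRel fun a b : ℕ => a ∣ b :=
  (primrecPred_eq_const (nat_mod.comp snd fst) 0).of_eq fun _ => Nat.dvd_iff_mod_eq_zero.symm

theorem coprime_iff_forall_lt {a b : ℕ} (hb : b ≠ 0) :
    a.Coprime b ↔ ∀ d < b + 1, d ∣ a → d ∣ b → d = 1 := by
  constructor
  · intro h d _ h1 h2
    exact Nat.eq_one_of_dvd_coprimes h h1 h2
  · intro h
    exact h _ (Nat.lt_succ_of_le (Nat.le_of_dvd (Nat.pos_of_ne_zero hb) (Nat.gcd_dvd_right a b)))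
      (Nat.gcd_dvd_left a b) (Nat.gcd_dvd_right a b)

theorem primrecPred_reduced :
    PrimrecPred fun q : ℤ × ℕ => q.2 ≠ 0 ∧ q.1.natAbs.Coprime q.2 := by
  have h : PrimrecPred fun q : ℤ × ℕ => q.2 ≠ 0 ∧
      ∀ d < q.2 + 1, d ∣ q.1.natAbs → d ∣ q.2 → d = 1 := by
    refine (primrecPred_eq_const snd 0).not.and (primrecPred_forall_lt (succ.comp snd) ?_)
    exact primrecPred_imp (primrecRel_dvd.comp snd (primrec_natAbs.comp (fst.comp fst)))
      (primrecPred_imp (primrecRel_dvd.comp snd (snd.comp fst)) (primrecPred_eq_const snd 1))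
  exact h.of_eq fun q => and_congr_right fun hq => (coprime_iff_forall_lt hq).symm

theorem primrec_lassoIdx {p L k : α → ℕ} (hp : Primrec p) (hL : Primrec L) (hk : Primrec k) :
    Primrec fun a => lassoIdx (p a) (L a) (k a) :=
  Primrec.ite (nat_lt.comp hk hp) hk
    (nat_add.comp hp (nat_mod.comp (nat_sub.comp hk hp) (nat_sub.comp hL hp)))

theorem primrec_tokenWeight : Primrec tokenWeight :=
  nat_mul.comp (succ.comp (fst.comp snd))
    (succ.comp (option_getD.comp (snd.comp snd) (const 0)))

theorem primrec_lassoBound {N : α → ℕ} {l : α → List Token} (hN : Primrec N) (hl : Primrec l) :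
    Primrec fun a => lassoBound (N a) (l a) := by
  have hpow : Primrec₂ ((· ^ ·) : ℕ → ℕ → ℕ) := Primrec₂.unpaired'.1 Nat.Primrec.pow
  have hsum : Primrec fun a => ((l a).map tokenWeight).sum :=
    (list_foldr (list_map hl (primrec_tokenWeight.comp₂ Primrec₂.right)) (const 0)
      (nat_add.comp (fst.comp snd) (snd.comp snd)).to₂).of_eq fun a => by
        simp [List.sum_eq_foldr]
  have hK := nat_mul.comp hN (hpow.comp (const 2) hsum)
  exact nat_mul.comp hK (nat_add.comp hK (const 2))

theorem primrec_words {N L : α → ℕ} (hN : Primrec N) (hL : Primrec L) :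
    Primrec fun a => words (N a) (L a) := by
  have h : Primrec fun a => Nat.rec (motive := fun _ => List (List ℕ)) [[]] (fun _ acc =>
      acc.flatMap fun l => (List.range (N a)).map fun s => s :: l) (L a) := by
    refine nat_rec' (h := fun a r => r.2.flatMap fun l => (List.range (N a)).map fun s => s :: l)
      hL (const ([[]] : List (List ℕ))) ?_
    refine list_flatMap (snd.comp snd) ?_
    exact list_map (list_range.comp (hN.comp (fst.comp fst)))
      (list_cons.comp snd (snd.comp fst)).to₂
  refine h.of_eq fun a => ?_
  generalize L a = m
  induction m with
  | zero => rfl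
  | succ m ih => simp only [words, ih]

theorem primrec_arity : Primrec arity :=
  Primrec.ite (primrecPred_eq_const Primrec.id 2) (const 1)
    (Primrec.ite ((primrecPred_eq_const Primrec.id 3).or (primrecPred_eq_const Primrec.id 4))
      (const 2) (const 0))

theorem primrecPred_holdsAt {e : α → LassoCode} {st : α → List (List Bool)} {c : α → Token}
    {k : α → ℕ} (he : Primrec e) (hst : Primrec st) (hc : Primrec c) (hk : Primrec k) :
    PrimrecPred fun a => HoldsAt (e a) (st a) (c a) (k a) := by
  have htag := fst.comp hc
  have harg := fst.comp (snd.comp hc)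
  have hopt := snd.comp (snd.comp hc)
  have hl := fst.comp (snd.comp he)
  have hp := snd.comp (snd.comp he)
  have hlen := list_length.comp hl
  have hst0 := primrec_getD hst (const 0) []
  have hst1 := primrec_getD hst (const 1) []
  refine (primrecPred_eq_const htag 0).or (.or ?_ (.or ?_ (.or ?_ ?_)))
  · exact (primrecPred_eq_const htag 1).and (primrecPred_int_nonneg.comp (fst.comp
      (primrec_getD (primrec_getD (fst.comp he) (primrec_getD hl hk 0) []) harg (0, 0))))
  · exact (primrecPred_eq_const htag 2).and (primrecPred_eq_const (primrec_getD hst0 hk _) _)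
  · exact (primrecPred_eq_const htag 3).and ((primrecPred_eq_const (primrec_getD hst1 hk _) _).and
      (primrecPred_eq_const (primrec_getD hst0 hk _) _))
  · refine (primrecPred_eq_const htag 4).and (primrecPred_exists_lt
      (succ.comp (nat_add.comp (nat_add.comp hk harg) hlen)) ?_)
    refine PrimrecPred.and (nat_le.comp (nat_add.comp (hk.comp fst) (harg.comp fst)) snd)
      (.and ?_ (.and ?_ ?_))
    · exact (primrecPred_eq_const (hopt.comp fst) none).or (nat_le.comp snd
        (nat_add.comp (hk.comp fst) (option_getD.comp (hopt.comp fst) (const 0))))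
    · exact primrecPred_eq_const (primrec_getD (hst0.comp fst)
        (primrec_lassoIdx (hp.comp fst) (hlen.comp fst) snd) _) _
    · refine primrecPred_forall_lt snd (primrecPred_imp
        (nat_le.comp (hk.comp (fst.comp fst)) snd) ?_)
      exact primrecPred_eq_const (primrec_getD (hst1.comp (fst.comp fst))
        (primrec_lassoIdx (hp.comp (fst.comp fst)) (hlen.comp (fst.comp fst)) snd) _) _

theorem primrec_evalStep {e : α → LassoCode} {st : α → List (List Bool)} {c : α → Token}
    (he : Primrec e) (hst : Primrec st) (hc : Primrec c) :
    Primrec fun a => evalStep (e a) (st a) (c a) := by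
  classical
  refine list_cons.comp (list_map (list_range.comp (list_length.comp (fst.comp (snd.comp he)))) ?_)
    (list_drop.comp (primrec_arity.comp (fst.comp hc)) hst)
  exact (primrecPred_holdsAt (he.comp fst) (hst.comp fst) (hc.comp fst) snd).decide

theorem primrec_foldl_evalStep {e : α → LassoCode} {l : α → List Token} (he : Primrec e)
    (hl : Primrec l) : Primrec fun a => (l a).foldl (evalStep (e a)) [] :=
  list_foldl (h := fun a r => evalStep (e a) r.1 r.2) hl (const [])
    (primrec_evalStep (he.comp fst) (fst.comp snd) (snd.comp snd))

theorem primrecPred_isLassoRun {ini : α → List Bool} {tr : α → List (List Bool)}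
    {l : α → List ℕ} {p : α → ℕ} (hini : Primrec ini) (htr : Primrec tr) (hl : Primrec l)
    (hp : Primrec p) : PrimrecPred fun a => IsLassoRun (ini a) (tr a) (l a) (p a) := by
  refine (primrecPred_eq_const (primrec_getD hini (primrec_getD hl (const 0) 0) _) _).and
    (primrecPred_forall_lt (list_length.comp hl) ?_)
  exact primrecPred_eq_const (primrec_getD
    (primrec_getD (htr.comp fst) (primrec_getD (hl.comp fst) snd 0) [])
    (primrec_getD (hl.comp fst) (primrec_lassoIdx (hp.comp fst)
      (list_length.comp (hl.comp fst)) (succ.comp snd)) 0) _) _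

theorem primrecPred_accepts : PrimrecPred Accepts := by
  have hsys : Primrec fun c : Code => c.2.1 := fst.comp snd
  have hN : Primrec fun c : Code => c.2.1.1 := fst.comp hsys
  have hini : Primrec fun c : Code => c.2.1.2.1 := fst.comp (snd.comp hsys)
  have htr : Primrec fun c : Code => c.2.1.2.2.1 := fst.comp (snd.comp (snd.comp hsys))
  have hval : Primrec fun c : Code => c.2.1.2.2.2 := snd.comp (snd.comp (snd.comp hsys))
  have htok : Primrec fun c : Code => c.2.2 := snd.comp snd
  -- The context `q` inside the three quantifiers of `Accepts` is `(((c, L), l), p)`.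
  have hc : Primrec fun q : ((Code × ℕ) × List ℕ) × ℕ => q.1.1.1 := fst.comp (fst.comp fst)
  have hl : Primrec fun q : ((Code × ℕ) × List ℕ) × ℕ => q.1.2 := snd.comp fst
  have hp : Primrec fun q : ((Code × ℕ) × List ℕ) × ℕ => q.2 := snd
  have heval := primrec_foldl_evalStep ((hval.comp hc).pair (hl.pair hp)) (htok.comp hc)
  have hbody := primrecPred_imp (primrecPred_isLassoRun (hini.comp hc) (htr.comp hc) hl hp)
    (primrecPred_eq_const (primrec_getD (primrec_getD heval (const 0) []) (const 0) false) true)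
  have hloops := primrecPred_forall_lt (snd.comp fst : Primrec fun q : (Code × ℕ) × List ℕ => q.1.2)
    hbody.primrecRel
  have hlists := primrecPred_forall_mem
    (primrec_words (hN.comp fst) snd : Primrec fun q : Code × ℕ => words q.1.2.1.1 q.2)
    hloops.primrecRel
  exact primrecPred_forall_lt (succ.comp (primrec_lassoBound hN htok)) hlists.primrecRel

theorem primrecPred_isToken {n : α → ℕ} {c : α → Token} (hn : Primrec n) (hc : Primrec c) :
    PrimrecPred fun a => IsToken (n a) (c a) :=
  (primrecPred_eq_const hc _).or <| .or ((primrecPred_eq_const (fst.comp hc) 1).and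
    ((nat_lt.comp (fst.comp (snd.comp hc)) hn).and (primrecPred_eq_const (snd.comp (snd.comp hc)) _)))
    <| (primrecPred_eq_const hc _).or <| (primrecPred_eq_const hc _).or <|
      primrecPred_eq_const (fst.comp hc) 4

theorem primrec_heightStep {n h : α → ℕ} {c : α → Token} (hn : Primrec n) (hh : Primrec h)
    (hc : Primrec c) : Primrec fun a => heightStep (n a) (h a) (c a) := by
  classical
  have har := primrec_arity.comp (fst.comp hc)
  exact Primrec.ite ((primrecPred_isToken hn hc).and (nat_lt.comp har hh))
    (succ.comp (nat_sub.comp hh har)) (const 0)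

theorem primrec_foldl_heightStep {n : α → ℕ} {l : α → List Token} (hn : Primrec n)
    (hl : Primrec l) : Primrec fun a => (l a).foldl (heightStep (n a)) 1 :=
  list_foldl (h := fun a r => heightStep (n a) r.1 r.2) hl (const 1)
    (primrec_heightStep (hn.comp fst) (fst.comp snd) (snd.comp snd))

theorem primrecPred_isSystemCode : PrimrecPred fun q : ℕ × SystemCode => IsSystemCode q.1 q.2 := by
  have hN : Primrec fun q : ℕ × SystemCode => q.2.1 := fst.comp snd
  have hini : Primrec fun q : ℕ × SystemCode => q.2.2.1 := fst.comp (snd.comp snd)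
  have htr : Primrec fun q : ℕ × SystemCode => q.2.2.2.1 := fst.comp (snd.comp (snd.comp snd))
  have hval : Primrec fun q : ℕ × SystemCode => q.2.2.2.2 := snd.comp (snd.comp (snd.comp snd))
  refine PrimrecPred.and (Primrec.eq.comp (list_length.comp hini) hN)
    (.and (Primrec.eq.comp (list_length.comp htr) hN) (.and ?_
      (.and (Primrec.eq.comp (list_length.comp hval) hN) ?_)))
  · exact primrecPred_forall_mem htr (Primrec.eq.comp (list_length.comp snd) (hN.comp fst))
  · refine primrecPred_forall_mem hval (PrimrecPred.and
      (Primrec.eq.comp (list_length.comp snd) (fst.comp fst)) ?_)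
    exact primrecPred_forall_mem snd (primrecPred_reduced.comp snd)

end Primrec

end SSTL

theorem mainTheorem3 :
    ComputablePred fun c : SSTL.Code =>
      ∃ I : SSTL.Instance, I.encode = c ∧ I.system.Satisfies I.formula := by
  have htok := SSTL.primrec_foldl_heightStep (α := SSTL.Code) Primrec.fst
    (Primrec.snd.comp Primrec.snd)
  have hsys : PrimrecPred fun c : SSTL.Code => SSTL.IsSystemCode c.1 c.2.1 :=
    SSTL.primrecPred_isSystemCode.comp (Primrec.fst.pair (Primrec.fst.comp Primrec.snd))
  exact ((hsys.and ((SSTL.primrecPred_eq_const htok 2).and SSTL.primrecPred_accepts)).of_eq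
    fun _ => SSTL.exists_instance_encode_iff.symm).computablePred
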